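/- **Notation.** $B(a,r)$ is the closed ball in $\mathbb R^3$, $\mathcal H^2$ is two-dimensional Hausdorff measure (normalized to be Lebesgue measure on planes), $\pi_H$ is the orthogonal projection onto a plane $H$, and for $\varphi\in(0,\pi/2)$, $w\in\mathbb S^2$, $C^{\pm}(\varphi,w)=\{y\in\mathbb R^3:\ \pm\, y\cdot w\ge |y|\cos\varphi\}$. *Admissible surfaces.* A compact connected set $\Sigma\subset\mathbb R^3$ is admissible if $\Sigma=\partial U$ for some bounded domain (nonempty connected open set) $U\subset\mathbb R^3$ such that 1. there is a constant $K>0$ with $\infty>\mathcal H^2(\Sigma\cap B(x,r))\ge K^{-1}r^2$ for all $x\in\Sigma$ and $0<r\le\operatorname{diam}\Sigma$; 2. there are a dense subset $\Sigma^*\subset\Sigma$ and, for each $x\in\Sigma^*$, a vector $v(x)\in\mathbb S^2$ and a radius $\delta_0(x)>0$ such that $B(x,\delta_0(x))\cap\big(x+C^+(\tfrac\pi4,v(x))\big)\subset U\cup\{x\}$ and $B(x,\delta_0(x))\cap\big(x+C^-(\tfrac\pi4,v(x))\big)\subset(\mathbb R^3\setminus\overline U)\cup\{x\}$. *Tetrahedra.*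 A tetrahedron is a quadruple $T=(x_0,x_1,x_2,x_3)$ of points of $\mathbb R^3$. For two tetrahedra, $\|T-T'\|=\min_{\sigma}\max_{0\le i\le3}|x_i-x'_{\sigma(i)}|$, where $\sigma$ runs over all permutations of $\{0,1,2,3\}$. For $\theta\in(0,1)$ and $d>0$, $T$ is $(\theta,d)$-voluminous if (a) $x_i\in B(x_0,2d)$ for $i=1,2,3$; (b) $|x_i-x_j|\ge\theta d$ for all $i\ne j$; (c) the angle between $x_1-x_0$ and $x_2-x_0$ lies in $[\theta,\pi-\theta]$; (d) the distance of $x_3$ from the plane through $x_0,x_1,x_2$ is at least $\theta d$. **Theorem.** There are absolute constants $\alpha,\eta\in(0,1)$ with $1>2\eta>40\alpha>0$ such that the following holds for every admissible surface $\Sigma$, with any choice of $U$, $\Sigma^*$, $v$, $\delta_0$ as in the definition, and every $x_0\in\Sigma^*$. There are a stopping distance $d_s=d_s(x_0)>0$ with $\delta_0(x_0)<d_s\le\operatorname{diam}\Sigma$ and points $x_1,x_2,x_3\in\Sigma$ such that 1. $T=(x_0,x_1,x_2,x_3)$ is $(\eta,d_s)$-voluminous; 2. every tetrahedron $T'$ in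 $\mathbb R^3$ with $\|T'-T\|\le\alpha d_s$ is $(\tfrac\eta2,\tfrac32d_s)$-voluminous. Moreover, for each $r\in(0,d_s]$ there is an affine plane $H=H(r)$ through $x_0$ with $$\pi_H\big(\Sigma\cap B(x_0,r)\big)\supset H\cap B\big(x_0,r/\sqrt2\big),$$ and $\mathcal H^2(\Sigma\cap B(x_0,r))\ge\tfrac\pi2r^2$. -/

import Mathlib

open Set Metric MeasureTheory
open scoped Real

/-- Euclidean three-space. -/
abbrev E3 : Type := EuclideanSpace ℝ (Fin 3)

/-- The closed half-cone `C⁺(φ, w) = {y : y ⬝ w ≥ |y| cos φ}` with vertex at the origin. -/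
def conePlus (φ : ℝ) (w : E3) : Set E3 := {y | ‖y‖ * Real.cos φ ≤ inner ℝ y w}

/-- The opposite closed half-cone `C⁻(φ, w) = {y : -(y ⬝ w) ≥ |y| cos φ}`. -/
def coneMinus (φ : ℝ) (w : E3) : Set E3 := {y | ‖y‖ * Real.cos φ ≤ -inner ℝ y w}

/-- A tetrahedron is a quadruple of points of space. -/
abbrev Tetrahedron : Type := Fin 4 → E3

/-- The distance `min_σ max_i |x_i - x'_{σ(i)}|` of two tetrahedra, the minimum being taken over
all permutations `σ` of the four indices (infimum and supremum are over finite nonempty sets). -/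
noncomputable def tetraDist (T T' : Tetrahedron) : ℝ :=
  ⨅ σ : Equiv.Perm (Fin 4), ⨆ i : Fin 4, ‖T i - T' (σ i)‖

/-- `T = (x₀, x₁, x₂, x₃)` is `(θ, d)`-voluminous. For `θ, d > 0` the separation and angle conditions make the base
points `x₀, x₁, x₂` non-collinear, so that their affine span is a plane. -/
structure IsVoluminous (θ d : ℝ) (T : Tetrahedron) : Prop where
  mem_ball : ∀ i, T i ∈ closedBall (T 0) (2 * d)
  le_dist : ∀ i j, i ≠ j → θ * d ≤ ‖T i - T j‖
  angle_mem : InnerProductGeometry.angle (T 1 - T 0) (T 2 - T 0) ∈ Icc θ (π - θ)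
  height : θ * d ≤ infDist (T 3) (affineSpan ℝ {T 0, T 1, T 2} : Set E3)

/-- `S` is an admissible surface, bounding the domain `U`; the subset `Sstar`, the unit vectors
`v x` and the radii `δ₀ x` for `x ∈ Sstar` are those in the double cone condition.
The measure `μHE[2]` is two-dimensional Hausdorff measure, normalized so that it is
Lebesgue measure on planes. -/
structure IsAdmissibleSurface (S U Sstar : Set E3) (v : E3 → E3) (δ₀ : E3 → ℝ) : Prop where
  compact : IsCompact S
  connected : IsConnected S
  domain_open : IsOpen U
  domain_connected : IsConnected U
  domain_bounded : Bornology.IsBounded U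
  eq_frontier : S = frontier U
  ahlfors : ∃ K : ℝ, 0 < K ∧ ∀ x ∈ S, ∀ r : ℝ, 0 < r → r ≤ diam S →
    μHE[2] (S ∩ closedBall x r) < ⊤ ∧
      ENNReal.ofReal (K⁻¹ * r ^ 2) ≤ μHE[2] (S ∩ closedBall x r)
  star_subset : Sstar ⊆ S
  star_dense : S ⊆ closure Sstar
  norm_axis : ∀ x ∈ Sstar, ‖v x‖ = 1
  radius_pos : ∀ x ∈ Sstar, 0 < δ₀ x
  cone_inside : ∀ x ∈ Sstar,
    closedBall x (δ₀ x) ∩ (fun y => x + y) '' conePlus (π / 4) (v x) ⊆ U ∪ {x}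
  cone_outside : ∀ x ∈ Sstar,
    closedBall x (δ₀ x) ∩ (fun y => x + y) '' coneMinus (π / 4) (v x) ⊆ (closure U)ᶜ ∪ {x}

/-! Call a radius good if, for some axis `w`, the cap of the sphere about `x` around `w` lies in `U`
and the opposite cap lies in the exterior. At a good radius every segment parallel to `w` joining
the two caps crosses the surface. Hence the surface projects onto a disc of radius `r / √2`, which
gives the area bound.

At a good radius `d`, two such crossings over orthogonal directions span with `x` a plane with
normal `n`. If a surface point within `7/5 * d` of `x` has height at least `d / 2` over this plane,
it completes a fat tetrahedron. Otherwise the surface stays in a slab near `x`, and all radii in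
`[d, 7/5 * d]` are good with axis `n` (`CapsSeparated.exists_tetrahedron_or_extend`). Good radii are
at most `diam S`, so extension must fail for `d` close to the supremum of the radii up to which all
are good (`IsAdmissibleSurface.exists_stopping`).

Fatness is measured by `TetraNondegenerate`, which is symmetric in the vertices, stable under
perturbation, and implies `IsVoluminous`. -/

/-! ### Quantitative nondegeneracy of tetrahedra -/

/-- Every affine relation with coefficients `l` moves the vertices by at least `c * |l i|`. -/
def TetraNondegenerate (c : ℝ) (T : Tetrahedron) : Prop :=
  ∀ l : Fin 4 → ℝ, ∑ i, l i = 0 → ∀ i, c * |l i| ≤ ‖∑ j, l j • T j‖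

theorem TetraNondegenerate.le_norm_sub {c : ℝ} {T : Tetrahedron} (h : TetraNondegenerate c T)
    {i j : Fin 4} (hij : i ≠ j) : c ≤ ‖T i - T j‖ := by
  have := h (Pi.single i 1 - Pi.single j 1) (by simp) i
  simpa [sub_smul, Pi.single_apply, hij] using this

theorem TetraNondegenerate.le_infDist {c : ℝ} {T : Tetrahedron} (h : TetraNondegenerate c T) :
    c ≤ infDist (T 3) (affineSpan ℝ {T 0, T 1, T 2} : Set E3) := by
  rw [Metric.le_infDist ⟨T 0, subset_affineSpan ℝ _ (by simp)⟩]
  intro y hy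
  have hle : affineSpan ℝ {T 0, T 1, T 2} ≤
      AffineSubspace.mk' (T 0) (Submodule.span ℝ {T 1 - T 0, T 2 - T 0}) := by
    rw [affineSpan_le]
    rintro z (rfl | rfl | rfl)
    · simp
    · simpa using Submodule.subset_span (by simp)
    · simpa using Submodule.subset_span (by simp)
  have hy' := hle hy
  rw [AffineSubspace.mem_mk', Submodule.mem_span_pair] at hy'
  obtain ⟨a, b, hab⟩ := hy'
  have key := h ![-(1 - a - b), -a, -b, 1] (by simp [Fin.sum_univ_four]; ring) 3
  have hy2 : y = T 0 + (a • (T 1 - T 0) + b • (T 2 - T 0)) := by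
    rw [hab]; simp
  rw [dist_eq_norm, hy2]
  have e : ∑ j, (![-(1 - a - b), -a, -b, 1] : Fin 4 → ℝ) j • T j =
      T 3 - (T 0 + (a • (T 1 - T 0) + b • (T 2 - T 0))) := by
    simp [Fin.sum_univ_four]; module
  rw [e] at key
  simpa using key

/-- A chord of the unit sphere is no longer than its arc: `2 - 2 cos θ ≤ θ ^ 2`. -/
theorem norm_normalize_sub_le_angle (a b : E3) (ha : a ≠ 0) (hb : b ≠ 0) :
    ‖(‖a‖⁻¹ • a) - ‖b‖⁻¹ • b‖ ≤ InnerProductGeometry.angle a b := by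
  have ha' := norm_pos_iff.2 ha
  have hb' := norm_pos_iff.2 hb
  rw [← sq_le_sq₀ (norm_nonneg _) (InnerProductGeometry.angle_nonneg a b)]
  rw [@norm_sub_sq_real, norm_smul, norm_smul, inner_smul_left, inner_smul_right]
  have h1 : ‖(‖a‖⁻¹ : ℝ)‖ * ‖a‖ = 1 := by simp [ha]
  have h2 : ‖(‖b‖⁻¹ : ℝ)‖ * ‖b‖ = 1 := by simp [hb]
  rw [h1, h2]
  have h3 := InnerProductGeometry.cos_angle a b
  have h4 := Real.one_sub_sq_div_two_le_cos (x := InnerProductGeometry.angle a b)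
  have h5 : (starRingEnd ℝ) ‖a‖⁻¹ * (‖b‖⁻¹ * inner ℝ a b) = inner ℝ a b / (‖a‖ * ‖b‖) := by
    simp; field_simp
  rw [h5, ← h3]
  linarith

theorem le_angle_of_forall_le_norm {c D : ℝ} {a b : E3} (ha : a ≠ 0) (hb : b ≠ 0)
    (haD : ‖a‖ ≤ D) (h : ∀ s t : ℝ, c * |s| ≤ ‖s • a + t • b‖) (hc : 0 ≤ c) :
    c / D ≤ InnerProductGeometry.angle a b := by
  refine le_trans ?_ (norm_normalize_sub_le_angle a b ha hb)
  have := h ‖a‖⁻¹ (-‖b‖⁻¹)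
  rw [neg_smul, ← sub_eq_add_neg] at this
  refine le_trans ?_ this
  rw [abs_of_nonneg (by positivity), div_eq_mul_inv]
  have := norm_pos_iff.2 ha
  gcongr

theorem TetraNondegenerate.isVoluminous {c θ d : ℝ} {T : Tetrahedron} (h : TetraNondegenerate c T)
    (hc : 0 < c) (hball : ∀ i, ‖T i - T 0‖ ≤ 2 * d) (hθ : θ * d ≤ c)
    (hθ' : θ ≤ c / (2 * d)) : IsVoluminous θ d T := by
  have h1 : T 1 - T 0 ≠ 0 := norm_pos_iff.1 (hc.trans_le (h.le_norm_sub (by decide)))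
  have h2 : T 2 - T 0 ≠ 0 := norm_pos_iff.1 (hc.trans_le (h.le_norm_sub (by decide)))
  have hst : ∀ s t : ℝ, c * |s| ≤ ‖s • (T 1 - T 0) + t • (T 2 - T 0)‖ := by
    intro s t
    have key := h ![-(s + t), s, t, 0] (by simp [Fin.sum_univ_four]) 1
    have e : ∑ j, (![-(s + t), s, t, 0] : Fin 4 → ℝ) j • T j =
        s • (T 1 - T 0) + t • (T 2 - T 0) := by
      simp [Fin.sum_univ_four]; module
    rw [e] at key
    simpa using key
  refine ⟨fun i => ?_, fun i j hij => hθ.trans (h.le_norm_sub hij), ⟨?_, ?_⟩,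
    hθ.trans h.le_infDist⟩
  · rw [mem_closedBall, dist_eq_norm]; exact hball i
  · exact hθ'.trans (le_angle_of_forall_le_norm h1 h2 (hball 1) hst hc.le)
  -- Replacing one edge by its negative turns the upper bound on the angle into a lower bound.
  · have := le_angle_of_forall_le_norm (D := 2 * d) (neg_ne_zero.2 h1) h2
      (by rw [norm_neg]; exact hball 1)
      (c := c) (fun s t => by rw [smul_neg, ← neg_smul, ← abs_neg]; exact hst (-s) t) hc.le
    rw [InnerProductGeometry.angle_neg_left] at this
    linarith

theorem TetraNondegenerate.perturb {c ε : ℝ} {T T' : Tetrahedron} (h : TetraNondegenerate c T)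
    (hε : 4 * ε ≤ c) (σ : Equiv.Perm (Fin 4)) (hT : ∀ i, ‖T' i - T (σ i)‖ ≤ ε) :
    TetraNondegenerate (c - 4 * ε) T' := by
  intro l hl
  -- With `|l k|` maximal, the four vertex errors add up to at most `4 * ε * |l k|`, which the bound
  -- at index `k` absorbs.
  obtain ⟨k, hk⟩ := Finite.exists_max fun i => |l i|
  have hε0 : 0 ≤ ε := (norm_nonneg _).trans (hT 0)
  have key := h (fun i => l (σ.symm i)) (by rw [Equiv.sum_comp σ.symm l, hl]) (σ k)
  simp only [Equiv.symm_apply_apply] at key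
  have e : ∑ j, l (σ.symm j) • T j = ∑ j, l j • T (σ j) := by
    rw [← Equiv.sum_comp σ]; simp
  rw [e] at key
  have e2 : ∑ j, l j • T (σ j) = ∑ j, l j • T' j - ∑ j, l j • (T' j - T (σ j)) := by
    rw [← Finset.sum_sub_distrib]; congr 1; ext1 j; module
  have e3 : ‖∑ j, l j • (T' j - T (σ j))‖ ≤ 4 * (|l k| * ε) := by
    refine (norm_sum_le _ _).trans ?_
    refine (Finset.sum_le_card_nsmul _ _ (|l k| * ε) fun j _ => ?_).trans (by simp)
    rw [norm_smul, Real.norm_eq_abs]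
    exact mul_le_mul (hk j) (hT j) (norm_nonneg _) (abs_nonneg _)
  rw [e2] at key
  have e4 := norm_sub_le (∑ j, l j • T' j) (∑ j, l j • (T' j - T (σ j)))
  intro i
  have : (c - 4 * ε) * |l i| ≤ (c - 4 * ε) * |l k| :=
    mul_le_mul_of_nonneg_left (hk i) (by linarith)
  linarith

theorem exists_perm_of_tetraDist_le {T T' : Tetrahedron} {ε : ℝ} (h : tetraDist T T' ≤ ε) :
    ∃ σ : Equiv.Perm (Fin 4), ∀ i, ‖T i - T' (σ i)‖ ≤ ε := by
  obtain ⟨σ, hσ⟩ := exists_eq_ciInf_of_finite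
    (f := fun σ : Equiv.Perm (Fin 4) => ⨆ i : Fin 4, ‖T i - T' (σ i)‖)
  refine ⟨σ, fun i => ?_⟩
  refine (le_ciSup (f := fun i => ‖T i - T' (σ i)‖) (Set.finite_range _).bddAbove i).trans ?_
  exact hσ.le.trans h

/-! ### Projections and area -/

theorem exists_orthonormal_pair (w : E3) (hw : ‖w‖ = 1) :
    ∃ u v : E3, ‖u‖ = 1 ∧ ‖v‖ = 1 ∧ inner ℝ u v = 0 ∧ inner ℝ u w = 0 ∧ inner ℝ v w = 0 := by
  have hw0 : w ≠ 0 := by rintro rfl; simp at hw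
  have : Fact (Module.finrank ℝ E3 = 2 + 1) := ⟨by simp⟩
  let b := OrthonormalBasis.fromOrthogonalSpanSingleton (𝕜 := ℝ) 2 hw0
  have hb : ∀ i, inner ℝ (b i : E3) w = 0 := fun i =>
    (Submodule.mem_orthogonal_singleton_iff_inner_left).1 (b i).2
  refine ⟨b 0, b 1, b.orthonormal.1 0, b.orthonormal.1 1, ?_, hb 0, hb 1⟩
  exact b.orthonormal.2 (i := 0) (j := 1) (by decide)

theorem inner_sq_add_inner_sq_le {u v : E3} (hu : ‖u‖ = 1) (hv : ‖v‖ = 1)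
    (huv : inner ℝ u v = 0) (z : E3) : inner ℝ u z ^ 2 + inner ℝ v z ^ 2 ≤ ‖z‖ ^ 2 := by
  have h : Orthonormal ℝ ![u, v] := by
    constructor
    · intro i; fin_cases i <;> simp [hu, hv]
    · intro i j hij
      fin_cases i <;> fin_cases j <;> simp_all [real_inner_comm]
  simpa [sq_abs] using h.sum_inner_products_le (x := z) (s := Finset.univ)

/-- The coordinates along `u` and `v` form a 1-Lipschitz map onto the plane whose image of `A`
contains a disc of radius `ρ`. -/
theorem measure_ge_of_projection {x u v w : E3} {ρ : ℝ} (hρ : 0 ≤ ρ) {A : Set E3}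
    (hu : ‖u‖ = 1) (hv : ‖v‖ = 1)
    (huv : inner ℝ u v = 0) (huw : inner ℝ u w = 0) (hvw : inner ℝ v w = 0)
    (h : ∀ p : E3, inner ℝ p w = 0 → ‖p‖ ≤ ρ → ∃ t : ℝ, x + p + t • w ∈ A) :
    ENNReal.ofReal (π * ρ ^ 2) ≤ μHE[2] A := by
  let f : E3 → EuclideanSpace ℝ (Fin 2) := fun y => !₂[inner ℝ u (y - x), inner ℝ v (y - x)]
  have hf : LipschitzWith 1 f := by
    refine LipschitzWith.of_dist_le_mul fun y z => ?_
    rw [EuclideanSpace.dist_eq, dist_eq_norm]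
    simp only [NNReal.coe_one, one_mul, Fin.sum_univ_two]
    rw [Real.sqrt_le_left (norm_nonneg _)]
    have := inner_sq_add_inner_sq_le hu hv huv (y - z)
    simp only [f, Real.dist_eq, sq_abs]
    simp only [Matrix.cons_val_zero, Matrix.cons_val_one]
    rw [← inner_sub_right, ← inner_sub_right]
    simpa using this
  have hsub : closedBall (0 : EuclideanSpace ℝ (Fin 2)) ρ ⊆ f '' A := by
    intro q hq
    have hq' : ‖q‖ ≤ ρ := by simpa using hq
    have hvu : inner ℝ v u = 0 := by rw [real_inner_comm]; exact huv
    obtain ⟨t, ht⟩ := h (q 0 • u + q 1 • v) (by simp [inner_add_left, inner_smul_left, huw, hvw])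
      (by
        refine le_trans (le_of_eq ?_) hq'
        rw [← sq_eq_sq₀ (norm_nonneg _) (norm_nonneg _), @norm_add_sq_real,
          EuclideanSpace.real_norm_sq_eq q, Fin.sum_univ_two]
        simp [norm_smul, hu, hv, inner_smul_left, inner_smul_right, huv])
    refine ⟨_, ht, ?_⟩
    ext i
    fin_cases i <;>
    simp [f, add_assoc, inner_add_right, inner_smul_right, huw, hvw, huv, hvu, hu, hv]
  have hvol : (μHE[2] : Measure (EuclideanSpace ℝ (Fin 2))) (closedBall 0 ρ) =
      ENNReal.ofReal (π * ρ ^ 2) := by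
    rw [EuclideanSpace.euclideanHausdorffMeasure_eq_volume,
      InnerProductSpace.volume_closedBall_of_dim_even (k := 1) (by simp)]
    rw [← ENNReal.ofReal_pow hρ, ← ENNReal.ofReal_mul (by positivity)]
    simp [mul_comm]
  rw [← hvol]
  refine (measure_mono hsub).trans ?_
  rw [Measure.euclideanHausdorffMeasure_def, Measure.euclideanHausdorffMeasure_def,
    Measure.smul_apply, Measure.smul_apply]
  gcongr
  simpa using hf.hausdorffMeasure_image_le (d := 2) (by norm_num) A

/-! ### Separated caps -/

theorem IsPreconnected.exists_mem_frontier {X : Type*} [TopologicalSpace X] {s t : Set X}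
    (ht : IsPreconnected t) (h1 : (t ∩ s).Nonempty) (h2 : (t ∩ sᶜ).Nonempty) :
    (t ∩ frontier s).Nonempty := by
  rw [frontier_eq_closure_inter_closure]
  refine isPreconnected_closed_iff.1 ht _ _ isClosed_closure isClosed_closure ?_
    (h1.mono (by gcongr; exact subset_closure)) (h2.mono (by gcongr; exact subset_closure))
  intro z _
  by_cases hz : z ∈ s
  · exact Or.inl (subset_closure hz)
  · exact Or.inr (subset_closure hz)

/-- On the sphere of radius `r` about `x`, the closed polar caps of half opening angle `π / 4`
around `w` and `-w` lie in `U` and in the exterior of `U`, respectively. -/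
def CapsSeparated (U : Set E3) (x : E3) (r : ℝ) (w : E3) : Prop :=
  ‖w‖ = 1 ∧ ∀ y : E3, ‖y‖ = r →
    (r * (√2 / 2) ≤ inner ℝ y w → x + y ∈ U) ∧
    (r * (√2 / 2) ≤ -inner ℝ y w → x + y ∈ (closure U)ᶜ)

theorem CapsSeparated.exists_mem_frontier {U : Set E3} {x w p : E3} {r : ℝ}
    (h : CapsSeparated U x r w) (hr : 0 < r) (hp : inner ℝ p w = 0) (hpr : ‖p‖ ≤ r * (√2 / 2)) :
    ∃ t : ℝ, x + p + t • w ∈ frontier U ∧ ‖p‖ ^ 2 + t ^ 2 ≤ r ^ 2 := by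
  obtain ⟨hw, h⟩ := h
  have h2 : √2 ^ 2 = 2 := Real.sq_sqrt (by norm_num)
  have hp2 : ‖p‖ ^ 2 ≤ r ^ 2 / 2 := by
    have := pow_le_pow_left₀ (norm_nonneg p) hpr 2
    nlinarith
  set τ := √(r ^ 2 - ‖p‖ ^ 2) with hτ
  have hτ2 : τ ^ 2 = r ^ 2 - ‖p‖ ^ 2 := Real.sq_sqrt (by nlinarith [sq_nonneg r])
  have hτ0 : 0 ≤ τ := Real.sqrt_nonneg _
  have hτr : r * (√2 / 2) ≤ τ := by
    rw [← sq_le_sq₀ (by positivity) hτ0]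
    nlinarith
  have hn : ∀ t : ℝ, ‖p + t • w‖ ^ 2 = ‖p‖ ^ 2 + t ^ 2 := by
    intro t
    rw [@norm_add_sq_real, inner_smul_right, hp, norm_smul, hw]
    simp
  have hi : ∀ t : ℝ, inner ℝ (p + t • w) w = t := by
    intro t
    rw [inner_add_left, hp, inner_smul_left, real_inner_self_eq_norm_sq, hw]
    simp
  have hnorm : ∀ t : ℝ, t ^ 2 = τ ^ 2 → ‖p + t • w‖ = r := by
    intro t ht
    rw [← sq_eq_sq₀ (norm_nonneg _) hr.le, hn, ht, hτ2]; ring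
  have hup : x + p + τ • w ∈ U := by
    rw [add_assoc]; exact (h _ (hnorm τ rfl)).1 (by rw [hi]; exact hτr)
  have hdn : x + p + (-τ) • w ∈ Uᶜ := by
    rw [add_assoc]
    exact fun hU => (h _ (hnorm (-τ) (by ring))).2 (by rw [hi]; linarith) (subset_closure hU)
  have hconn : IsPreconnected ((fun t : ℝ => x + p + t • w) '' Icc (-τ) τ) :=
    isPreconnected_Icc.image _ (by fun_prop)
  obtain ⟨z, ⟨t, ht, rfl⟩, hz⟩ := IsPreconnected.exists_mem_frontier hconn (s := U)
    ⟨_, ⟨τ, by simp [hτ0], rfl⟩, hup⟩ ⟨_, ⟨-τ, by simp [hτ0], rfl⟩, hdn⟩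
  refine ⟨t, hz, ?_⟩
  have : t ^ 2 ≤ τ ^ 2 := sq_le_sq' ht.1 ht.2
  linarith

/-- The slab of half-width `d / 2` cuts the ball into two outer convex pieces that miss the surface.
Since `1 / 2 ≤ ⟪w, n⟫`, they contain the old poles `x ± d • w`, which decide their sides. The new
caps lie in these pieces because `d / 2 ≤ r * (√2 / 2)`. -/
theorem CapsSeparated.of_flat {U : Set E3} {x w n : E3} {d : ℝ} (h : CapsSeparated U x d w)
    (hU : IsOpen U) (hd : 0 < d) (hn : ‖n‖ = 1) (hwn : 1 / 2 ≤ inner ℝ w n)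
    (hflat : ∀ y : E3, ‖y‖ ≤ 7 / 5 * d → x + y ∈ frontier U → |inner ℝ y n| < d / 2)
    {r : ℝ} (hr : d ≤ r) (hr' : r ≤ 7 / 5 * d) : CapsSeparated U x r n := by
  have hs : (1 : ℝ) ≤ √2 := Real.one_le_sqrt.2 (by norm_num)
  have hs2 : √2 ≤ 2 := Real.sqrt_le_iff.2 (by norm_num)
  have hconv : ∀ m : E3, IsPreconnected
      ((fun y => x + y) '' (closedBall 0 (7 / 5 * d) ∩ {y : E3 | d / 2 ≤ inner ℝ m y})) :=
    fun m => (((convex_closedBall _ _).inter (convex_halfSpace_ge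
      (innerSL ℝ m).isLinear _)).isPreconnected).image _ (by fun_prop)
  have hself : inner ℝ w w = 1 := by rw [real_inner_self_eq_norm_sq, h.1]; norm_num
  have hnw : 1 / 2 ≤ inner ℝ n w := by rwa [real_inner_comm]
  have hrd : d / 2 ≤ r * (√2 / 2) := by nlinarith
  have hup : ∀ y : E3, ‖y‖ ≤ 7 / 5 * d → d / 2 ≤ inner ℝ y n → x + y ∈ U := by
    intro y hy hyn
    by_contra hyU
    obtain ⟨_, ⟨z, ⟨hz, hzn⟩, rfl⟩, hzU⟩ := IsPreconnected.exists_mem_frontier (hconv n) (s := U)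
      ⟨x + d • w, ⟨d • w, ⟨by simp [norm_smul, h.1, abs_of_pos hd]; linarith,
        by simp [inner_smul_right]; nlinarith⟩, rfl⟩,
        (h.2 _ (by simp [norm_smul, h.1, abs_of_pos hd])).1
          (by rw [inner_smul_left, hself]; simp; nlinarith)⟩
      ⟨_, ⟨y, ⟨by simpa using hy, by rwa [mem_ofPred_eq, real_inner_comm]⟩, rfl⟩, hyU⟩
    have := hflat z (by simpa using hz) hzU
    rw [mem_ofPred_eq, real_inner_comm] at hzn
    exact absurd (le_abs_self _) (not_le.2 (this.trans_le hzn))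
  have hdn : ∀ y : E3, ‖y‖ ≤ 7 / 5 * d → d / 2 ≤ -inner ℝ y n → x + y ∈ (closure U)ᶜ := by
    intro y hy hyn hyU
    have hyU' : x + y ∈ U := by
      by_contra hyU'
      have := hflat y hy (by rw [hU.frontier_eq]; exact ⟨hyU, hyU'⟩)
      exact absurd (neg_le_abs _) (not_le.2 (this.trans_le hyn))
    obtain ⟨_, ⟨z, ⟨hz, hzn⟩, rfl⟩, hzU⟩ := IsPreconnected.exists_mem_frontier (hconv (-n)) (s := U)
      ⟨_, ⟨y, ⟨by simpa using hy, by rwa [mem_ofPred_eq, inner_neg_left, real_inner_comm]⟩,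
        rfl⟩, hyU'⟩
      ⟨x + (-d) • w, ⟨(-d) • w, ⟨by simp [norm_smul, h.1, abs_of_pos hd]; linarith,
        by simp [inner_smul_right]; nlinarith⟩, rfl⟩,
        fun hc => (h.2 _ (by simp [norm_smul, h.1, abs_of_pos hd])).2
          (by rw [inner_smul_left, hself]; simp; nlinarith) (subset_closure hc)⟩
    have := hflat z (by simpa using hz) hzU
    rw [mem_ofPred_eq, inner_neg_left, real_inner_comm] at hzn
    exact absurd (neg_le_abs _) (not_le.2 (this.trans_le hzn))
  exact ⟨hn, fun y hy => ⟨fun h1 => hup y (hy.trans_le hr') (hrd.trans h1),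
    fun h1 => hdn y (hy.trans_le hr') (hrd.trans h1)⟩⟩

/-! ### Small radii and openness -/

theorem IsAdmissibleSurface.capsSeparated {S U Sstar : Set E3} {v : E3 → E3} {δ₀ : E3 → ℝ}
    (h : IsAdmissibleSurface S U Sstar v δ₀) {x : E3} (hx : x ∈ Sstar) {r : ℝ} (hr : 0 < r)
    (hrδ : r ≤ δ₀ x) : CapsSeparated U x r (v x) := by
  refine ⟨h.norm_axis x hx, fun y hy => ?_⟩
  have hb : x + y ∈ closedBall x (δ₀ x) := by simpa [hy] using hrδ
  have hne : x + y ∉ ({x} : Set E3) := by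
    have : y ≠ 0 := norm_pos_iff.1 (hy ▸ hr)
    simpa using this
  refine ⟨fun h1 => ?_, fun h1 => ?_⟩
  · refine (h.cone_inside x hx ⟨hb, y, ?_, rfl⟩).resolve_right hne
    simpa [conePlus, hy] using h1
  · refine (h.cone_outside x hx ⟨hb, y, ?_, rfl⟩).resolve_right hne
    simpa [coneMinus, hy] using h1

theorem IsCompact.exists_scaling_subset {K U : Set E3} {x : E3} {δ : ℝ} (hδ : 0 < δ)
    (hU : IsOpen U) (hK : IsCompact K) (hKU : ∀ y ∈ K, x + y ∈ U) :
    ∃ ε > 0, ∀ r, δ ≤ r → r < δ + ε → ∀ y : E3, ‖y‖ = r → (δ / r) • y ∈ K → x + y ∈ U := by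
  obtain ⟨ε, hε, hsub⟩ := hK.exists_thickening_subset_open
    (hU.preimage (continuous_const.add continuous_id : Continuous fun y : E3 => x + y)) hKU
  refine ⟨ε, hε, fun r hr hr' y hy hyK => hsub (mem_thickening_iff.2 ⟨_, hyK, ?_⟩)⟩
  have hr0 : 0 < r := hδ.trans_le hr
  have e : y - (δ / r) • y = (1 - δ / r) • y := by module
  rw [dist_eq_norm, e, norm_smul, hy, Real.norm_eq_abs,
    abs_of_nonneg (sub_nonneg.2 ((div_le_one hr0).2 hr))]
  field_simp
  linarith

/-- The caps are compact inside open sets, so slight radial dilation keeps them there. This makes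
the stopping distance strictly larger than `δ₀ x`. -/
theorem CapsSeparated.exists_extend {U : Set E3} {x w : E3} {δ : ℝ} (h : CapsSeparated U x δ w)
    (hU : IsOpen U) (hδ : 0 < δ) :
    ∃ ε > 0, ∀ r, δ ≤ r → r < δ + ε → CapsSeparated U x r w := by
  have hcomp : ∀ m : E3, IsCompact (sphere (0 : E3) δ ∩ {y | δ * (√2 / 2) ≤ inner ℝ m y}) :=
    fun m => (isCompact_sphere _ _).inter_right (isClosed_le (by fun_prop) (by fun_prop))
  obtain ⟨ε₁, hε₁, h₁⟩ := IsCompact.exists_scaling_subset hδ hU (hcomp w) (x := x)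
    (fun y hy => (h.2 y (by simpa using hy.1)).1 (by rw [real_inner_comm]; exact hy.2))
  obtain ⟨ε₂, hε₂, h₂⟩ := IsCompact.exists_scaling_subset hδ
    (isClosed_closure (s := U)).isOpen_compl (hcomp (-w)) (x := x)
    (fun y hy => (h.2 y (by simpa using hy.1)).2
      (by rw [real_inner_comm, ← inner_neg_left]; exact hy.2))
  refine ⟨min ε₁ ε₂, lt_min hε₁ hε₂, fun r hr hr' => ⟨h.1, fun y hy => ?_⟩⟩
  have hr0 : 0 < r := hδ.trans_le hr
  have hnorm : (δ / r) • y ∈ sphere (0 : E3) δ := by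
    rw [mem_sphere_zero_iff_norm, norm_smul, hy, Real.norm_eq_abs, abs_of_pos (by positivity)]
    field_simp
  have hscale : ∀ a : ℝ, r * (√2 / 2) ≤ a → δ * (√2 / 2) ≤ δ / r * a := by
    intro a ha
    calc δ * (√2 / 2) = δ / r * (r * (√2 / 2)) := by field_simp
      _ ≤ _ := by gcongr
  refine ⟨fun hyw => h₁ r hr (hr'.trans_le (by gcongr; exact min_le_left _ _)) y hy ⟨hnorm, ?_⟩,
    fun hyw => h₂ r hr (hr'.trans_le (by gcongr; exact min_le_right _ _)) y hy ⟨hnorm, ?_⟩⟩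
  · rw [mem_ofPred_eq, inner_smul_right, real_inner_comm]
    exact hscale _ hyw
  · rw [mem_ofPred_eq, inner_smul_right, inner_neg_left, real_inner_comm]
    exact hscale _ hyw

/-! ### Constructing fat tetrahedra -/

theorem abs_inner_le_of_norm_eq_one {u : E3} (hu : ‖u‖ = 1) (z : E3) : |inner ℝ z u| ≤ ‖z‖ := by
  simpa [hu] using abs_real_inner_le_norm z u

theorem tetraNondegenerate_of_frame {x a b e u v n : E3} {k d : ℝ} (hd : 0 < d)
    (hu : ‖u‖ = 1) (hv : ‖v‖ = 1) (hn : ‖n‖ = 1)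
    (hau : inner ℝ a u = k) (hbu : inner ℝ b u = 0) (hav : inner ℝ a v = 0) (hbv : inner ℝ b v = k)
    (han : inner ℝ a n = 0) (hbn : inner ℝ b n = 0) (hk : 7 / 10 * d ≤ k)
    (he : ‖e‖ ≤ 7 / 5 * d) (hen : d / 2 ≤ |inner ℝ e n|) :
    TetraNondegenerate (d / 14) ![x, x + a, x + b, x + e] := by
  intro l hl
  rw [Fin.sum_univ_four] at hl
  have hz : ∑ j, l j • (![x, x + a, x + b, x + e] : Tetrahedron) j =
      l 1 • a + l 2 • b + l 3 • e := by
    have : l 0 = -l 1 - l 2 - l 3 := by linarith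
    simp [Fin.sum_univ_four, this]; module
  rw [hz]
  set z := l 1 • a + l 2 • b + l 3 • e with hzdef
  have hinner : ∀ m : E3, inner ℝ z m = l 1 * inner ℝ a m + l 2 * inner ℝ b m + l 3 * inner ℝ e m :=
    fun m => by simp [hzdef, inner_add_left, inner_smul_left]
  -- Pairing with `n` isolates `l 3`; pairing with `u` and `v` then isolates `l 1` and `l 2` up to
  -- this term. The bounds `2`, `6`, `6` for `d * |l i| / ‖z‖` add up to `14` for `l 0`.
  have h3 : |l 3| * (d / 2) ≤ ‖z‖ := by
    refine le_trans ?_ (abs_inner_le_of_norm_eq_one hn z)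
    rw [hinner, han, hbn, mul_zero, mul_zero, zero_add, zero_add, abs_mul]
    gcongr
  have aux : ∀ (m : E3) (c : ℝ), ‖m‖ = 1 → inner ℝ z m = c * k + l 3 * inner ℝ e m →
      d * |c| ≤ 6 * ‖z‖ := by
    intro m c hm hc
    have h4 := abs_inner_le_of_norm_eq_one hm z
    have h5 := (abs_inner_le_of_norm_eq_one hm e).trans he
    have h6 : |c * k| ≤ ‖z‖ + |l 3| * (7 / 5 * d) := by
      have : c * k = inner ℝ z m - l 3 * inner ℝ e m := by rw [hc]; ring
      rw [this]
      refine (abs_sub _ _).trans (add_le_add h4 ?_)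
      rw [abs_mul]; gcongr
    have h7 : 7 / 10 * d * |c| ≤ |c * k| := by
      rw [abs_mul, mul_comm |c|]
      gcongr
      exact hk.trans (le_abs_self k)
    linarith [norm_nonneg z]
  have h1 := aux u (l 1) hu (by rw [hinner, hau, hbu]; ring)
  have h2 := aux v (l 2) hv (by rw [hinner, hav, hbv]; ring)
  have h0 : d * |l 0| ≤ 14 * ‖z‖ := by
    have : |l 0| ≤ |l 1| + |l 2| + |l 3| := by
      have : l 0 = -(l 1 + l 2 + l 3) := by linarith
      rw [this, abs_neg]; exact abs_add_three _ _ _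
    nlinarith
  have := norm_nonneg z
  intro i
  fin_cases i <;> simp only [Fin.zero_eta, Fin.mk_one, Fin.reduceFinMk] <;> linarith

theorem exists_unit_normal {u v w : E3} (hu : ‖u‖ = 1) (hv : ‖v‖ = 1) (hw : ‖w‖ = 1)
    (huv : inner ℝ u v = 0) (huw : inner ℝ u w = 0) (hvw : inner ℝ v w = 0) {k s t : ℝ}
    (hk : 0 < k) (hs : s ^ 2 ≤ k ^ 2) (ht : t ^ 2 ≤ k ^ 2) :
    ∃ n : E3, ‖n‖ = 1 ∧ 1 / 2 ≤ inner ℝ w n ∧ inner ℝ (k • u + s • w) n = 0 ∧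
      inner ℝ (k • v + t • w) n = 0 := by
  have huu : inner ℝ u u = 1 := by rw [real_inner_self_eq_norm_sq, hu]; norm_num
  have hvv : inner ℝ v v = 1 := by rw [real_inner_self_eq_norm_sq, hv]; norm_num
  have hww : inner ℝ w w = 1 := by rw [real_inner_self_eq_norm_sq, hw]; norm_num
  have hvu : inner ℝ v u = 0 := by rw [real_inner_comm]; exact huv
  have hwu : inner ℝ w u = 0 := by rw [real_inner_comm]; exact huw
  have hwv : inner ℝ w v = 0 := by rw [real_inner_comm]; exact hvw
  -- `m` is orthogonal to both edges, and `‖m‖ ^ 2 ≤ 3 * k ^ 2` bounds its tilt from `w`.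
  set m : E3 := k • w - s • u - t • v with hm
  have hmm : ‖m‖ ^ 2 = k ^ 2 + s ^ 2 + t ^ 2 := by
    rw [← real_inner_self_eq_norm_sq, hm]
    simp only [inner_sub_left, inner_sub_right, inner_smul_left, inner_smul_right, huu, hvv, hww,
      huv, huw, hvw, hvu, hwu, hwv, conj_trivial]
    ring
  have hm0 : 0 < ‖m‖ := by
    refine norm_pos_iff.2 fun h => ?_
    rw [h, norm_zero] at hmm
    nlinarith
  have hmk : ‖m‖ ≤ 2 * k := by
    rw [← sq_le_sq₀ hm0.le (by positivity)]
    nlinarith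
  have hwm : inner ℝ w m = k := by
    simp [hm, inner_sub_right, inner_smul_right, hw, hwu, hwv]
  refine ⟨‖m‖⁻¹ • m, ?_, ?_, ?_, ?_⟩
  · simp [norm_smul, hm0.ne']
  · rw [inner_smul_right, hwm, ← div_eq_inv_mul, div_le_div_iff₀ (by norm_num) hm0]
    linarith
  · rw [inner_smul_right, inner_add_left, inner_smul_left, inner_smul_left, hwm, hm]
    simp [inner_sub_right, inner_smul_right, hu, huv, huw]
    right; ring
  · rw [inner_smul_right, inner_add_left, inner_smul_left, inner_smul_left, hwm, hm]
    simp [inner_sub_right, inner_smul_right, hv, hvu, hvw]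
    right; ring

theorem TetraNondegenerate.isVoluminous_of_tetraDist_le {T T' : Tetrahedron} {d : ℝ} (hd : 0 < d)
    (h : TetraNondegenerate (d / 14) T) (hball : ∀ i, ‖T i - T 0‖ ≤ 7 / 5 * d)
    (hT : tetraDist T' T ≤ 1 / 10000 * d) : IsVoluminous (1 / 100 / 2) (3 / 2 * d) T' := by
  obtain ⟨σ, hσ⟩ := exists_perm_of_tetraDist_le hT
  refine (h.perturb (by linarith) σ hσ).isVoluminous (by linarith) (fun i => ?_) (by linarith) ?_
  · have e : T' i - T' 0 = (T' i - T (σ i)) + (T (σ i) - T 0) - (T (σ 0) - T 0) -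
        (T' 0 - T (σ 0)) := by abel
    rw [e]
    refine (norm_sub_le _ _).trans ?_
    have h1 := norm_sub_le ((T' i - T (σ i)) + (T (σ i) - T 0)) (T (σ 0) - T 0)
    have h2 := norm_add_le (T' i - T (σ i)) (T (σ i) - T 0)
    linarith [hσ i, hσ 0, hball (σ i), hball (σ 0)]
  · rw [le_div_iff₀ (by positivity)]
    linarith

/-! ### Consequences at a good radius -/

theorem CapsSeparated.projection {U : Set E3} {x w : E3} {r : ℝ} (h : CapsSeparated U x r w)
    (hr : 0 < r) :
    (∃ (H : AffineSubspace ℝ E3) (_ : Nonempty H),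
      Module.finrank ℝ H.direction = 2 ∧ x ∈ H ∧
      (H : Set E3) ∩ closedBall x (r / √2) ⊆
        (fun y => (EuclideanGeometry.orthogonalProjection H y : E3)) ''
          (frontier U ∩ closedBall x r)) ∧
    ENNReal.ofReal (π / 2 * r ^ 2) ≤ μHE[2] (frontier U ∩ closedBall x r) := by
  have hsq : r / √2 = r * (√2 / 2) := by
    rw [Real.sqrt_div_self', mul_one_div]
  have hw0 : w ≠ 0 := fun h0 => by simpa [h0] using h.1
  have hmem : ∀ p : E3, inner ℝ p w = 0 → ‖p‖ ≤ r * (√2 / 2) →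
      ∃ t : ℝ, x + p + t • w ∈ frontier U ∩ closedBall x r := by
    intro p hp hpr
    obtain ⟨t, ht, htr⟩ := h.exists_mem_frontier hr hp hpr
    refine ⟨t, ht, ?_⟩
    rw [mem_closedBall, dist_eq_norm, add_assoc, add_sub_cancel_left,
      ← sq_le_sq₀ (norm_nonneg _) hr.le, @norm_add_sq_real, inner_smul_right, hp, norm_smul, h.1]
    simpa using htr
  constructor
  · have : Fact (Module.finrank ℝ E3 = 2 + 1) := ⟨by simp⟩
    refine ⟨AffineSubspace.mk' x (ℝ ∙ w)ᗮ, ⟨x, AffineSubspace.self_mem_mk' _ _⟩, ?_,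
      AffineSubspace.self_mem_mk' _ _, ?_⟩
    · rw [AffineSubspace.direction_mk']
      exact Submodule.finrank_orthogonal_span_singleton hw0
    · rintro y ⟨hy, hyr⟩
      have hyw : inner ℝ (y - x) w = 0 := by
        rw [SetLike.mem_coe, AffineSubspace.mem_mk', vsub_eq_sub] at hy
        exact Submodule.mem_orthogonal_singleton_iff_inner_left.1 hy
      obtain ⟨t, ht⟩ := hmem (y - x) hyw (by rw [← hsq, ← dist_eq_norm]; exact hyr)
      refine ⟨_, ht, ?_⟩
      have e : x + (y - x) + t • w = (t • w) +ᵥ y := by rw [vadd_eq_add]; abel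
      have : Nonempty (AffineSubspace.mk' x (ℝ ∙ w)ᗮ) := ⟨x, AffineSubspace.self_mem_mk' _ _⟩
      simp only [e]
      rw [EuclideanGeometry.orthogonalProjection_vadd_eq_self hy]
      rw [AffineSubspace.direction_mk']
      exact Submodule.le_orthogonal_orthogonal _
        (Submodule.smul_mem _ _ (Submodule.mem_span_singleton_self w))
  · obtain ⟨u, v, hu, hv, huv, huw, hvw⟩ := exists_orthonormal_pair w h.1
    have := measure_ge_of_projection (by positivity) hu hv huv huw hvw hmem
    convert this using 2
    have : √2 ^ 2 = 2 := Real.sq_sqrt (by norm_num)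
    rw [mul_pow, div_pow, this]; ring

theorem CapsSeparated.exists_tetrahedron_or_extend {U : Set E3} {x w : E3} {d : ℝ}
    (h : CapsSeparated U x d w) (hU : IsOpen U) (hUb : Bornology.IsBounded U) (hd : 0 < d) :
    d ≤ diam (frontier U) ∧
    ((∃ T : Tetrahedron, T 0 = x ∧ T 1 ∈ frontier U ∧ T 2 ∈ frontier U ∧ T 3 ∈ frontier U ∧
        TetraNondegenerate (d / 14) T ∧ ∀ i, ‖T i - T 0‖ ≤ 7 / 5 * d) ∨
      ∃ n : E3, ∀ r, d ≤ r → r ≤ 7 / 5 * d → CapsSeparated U x r n) := by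
  obtain ⟨u, v, hu, hv, huv, huw, hvw⟩ := exists_orthonormal_pair w h.1
  have hvu : inner ℝ v u = 0 := by rw [real_inner_comm]; exact huv
  have hwu : inner ℝ w u = 0 := by rw [real_inner_comm]; exact huw
  have hwv : inner ℝ w v = 0 := by rw [real_inner_comm]; exact hvw
  have h2 : √2 ^ 2 = 2 := Real.sq_sqrt (by norm_num)
  set k := d * (√2 / 2) with hk
  have hk0 : 0 < k := by positivity
  have hk2 : k ^ 2 = d ^ 2 / 2 := by rw [hk, mul_pow, div_pow, h2]; ring
  have hkd : 7 / 10 * d ≤ k := by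
    rw [← sq_le_sq₀ (by positivity) hk0.le]; nlinarith [sq_nonneg d]
  have hnorm : ∀ (m : E3) (s : ℝ), ‖m‖ = 1 → inner ℝ m w = 0 → s ^ 2 ≤ k ^ 2 →
      ‖k • m + s • w‖ ≤ d := by
    intro m s hm hmw hs
    rw [← sq_le_sq₀ (norm_nonneg _) hd.le, @norm_add_sq_real, inner_smul_right, inner_smul_left,
      hmw, norm_smul, norm_smul, hm, h.1]
    simp
    linarith
  have hex : ∀ m : E3, ‖m‖ = 1 → inner ℝ m w = 0 →
      ∃ s : ℝ, x + (k • m + s • w) ∈ frontier U ∧ s ^ 2 ≤ k ^ 2 := by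
    intro m hm hmw
    have hkm : ‖k • m‖ = k := by rw [norm_smul, hm, Real.norm_eq_abs, abs_of_pos hk0, mul_one]
    obtain ⟨s, hs, hs2⟩ := h.exists_mem_frontier hd (p := k • m) (by simp [inner_smul_left, hmw])
      hkm.le
    refine ⟨s, by rwa [← add_assoc], ?_⟩
    rw [hkm] at hs2
    linarith
  obtain ⟨s, hsU, hs⟩ := hex u hu huw
  obtain ⟨t, htU, ht⟩ := hex v hv hvw
  have ha := hnorm u s hu huw hs
  have hb := hnorm v t hv hvw ht
  obtain ⟨n, hn, hwn, han, hbn⟩ := exists_unit_normal hu hv h.1 huv huw hvw hk0 hs ht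
  have hau : inner ℝ (k • u + s • w) u = k := by
    simp [inner_add_left, inner_smul_left, hu, hwu]
  have hav : inner ℝ (k • u + s • w) v = 0 := by
    simp [inner_add_left, inner_smul_left, huv, hwv]
  have hbu : inner ℝ (k • v + t • w) u = 0 := by
    simp [inner_add_left, inner_smul_left, hvu, hwu]
  have hbv : inner ℝ (k • v + t • w) v = k := by
    simp [inner_add_left, inner_smul_left, hv, hwv]
  set a := k • u + s • w
  set b := k • v + t • w
  refine ⟨?_, ?_⟩
  -- The two crossings differ by `k` along both `u` and `v`, so their distance is at least `√2 * k =
  -- d`.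
  · have hbd : Bornology.IsBounded (frontier U) := hUb.closure.subset frontier_subset_closure
    refine le_trans ?_ (dist_le_diam_of_mem hbd hsU htU)
    rw [dist_eq_norm, add_sub_add_left_eq_sub, ← sq_le_sq₀ hd.le (norm_nonneg _)]
    have := inner_sq_add_inner_sq_le hu hv huv (a - b)
    rw [real_inner_comm, inner_sub_left, hau, hbu, real_inner_comm, inner_sub_left, hav, hbv] at this
    linarith
  by_cases hflat : ∀ y : E3, ‖y‖ ≤ 7 / 5 * d → x + y ∈ frontier U → |inner ℝ y n| < d / 2
  · exact Or.inr ⟨n, fun r hr hr' => h.of_flat hU hd hn hwn hflat hr hr'⟩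
  · push Not at hflat
    obtain ⟨e, he, heU, hen⟩ := hflat
    refine Or.inl ⟨![x, x + a, x + b, x + e], rfl, hsU, htU, heU,
      tetraNondegenerate_of_frame hd hu hv hn hau hbu hav hbv han hbn hkd he hen, fun i => ?_⟩
    fin_cases i <;> simp <;> linarith

/-! ### The stopping distance -/

theorem IsAdmissibleSurface.exists_stopping {S U Sstar : Set E3} {v : E3 → E3} {δ₀ : E3 → ℝ}
    (h : IsAdmissibleSurface S U Sstar v δ₀) {x : E3} (hx : x ∈ Sstar) :
    ∃ d : ℝ, δ₀ x < d ∧ d ≤ diam S ∧ (∀ r ∈ Ioc 0 d, ∃ w, CapsSeparated U x r w) ∧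
      ∃ T : Tetrahedron, T 0 = x ∧ T 1 ∈ S ∧ T 2 ∈ S ∧ T 3 ∈ S ∧
        TetraNondegenerate (d / 14) T ∧ ∀ i, ‖T i - T 0‖ ≤ 7 / 5 * d := by
  have hδ := h.radius_pos x hx
  have hS := h.eq_frontier
  set R : Set ℝ := {r | 0 < r ∧ ∀ r' ∈ Ioc 0 r, ∃ w, CapsSeparated U x r' w} with hR
  have hstep : ∀ r ∈ R, r ≤ diam S ∧ _ := fun r hr => by
    obtain ⟨w, hw⟩ := hr.2 r ⟨hr.1, le_rfl⟩
    rw [hS]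
    exact hw.exists_tetrahedron_or_extend h.domain_open h.domain_bounded hr.1
  have hbdd : BddAbove R := ⟨diam S, fun r hr => (hstep r hr).1⟩
  obtain ⟨ε, hε, hext⟩ :=
    (h.capsSeparated hx hδ le_rfl).exists_extend h.domain_open hδ
  have hmemR : δ₀ x + ε / 2 ∈ R := by
    refine ⟨by positivity, fun r hr => ⟨v x, ?_⟩⟩
    rcases le_total r (δ₀ x) with hle | hle
    · exact h.capsSeparated hx hr.1 hle
    · exact hext r hle (by linarith [hr.2])
  have hsup : δ₀ x + ε / 2 ≤ sSup R := le_csSup hbdd hmemR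
  -- Beyond `5/7` of the supremum, an extension to `7/5 * d` would overshoot it.
  obtain ⟨d, hdR, hdlt⟩ := exists_lt_of_lt_csSup ⟨_, hmemR⟩
    (max_lt (by linarith) (by linarith) : max (δ₀ x) (5 / 7 * sSup R) < sSup R)
  refine ⟨d, (le_max_left _ _).trans_lt hdlt, (hstep d hdR).1, hdR.2, ?_⟩
  rcases (hstep d hdR).2 with hT | ⟨n, hn⟩
  · rwa [← hS] at hT
  · exfalso
    have : 7 / 5 * d ∈ R := by
      refine ⟨by linarith [hdR.1], fun r hr => ?_⟩
      rcases le_total r d with hle | hle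
      · exact hdR.2 r ⟨hr.1, hle⟩
      · exact ⟨n, hn r hle hr.2⟩
    have h1 := le_csSup hbdd this
    have h2 := (le_max_right _ _).trans_lt hdlt
    linarith

theorem theorem3p3 :
    ∃ α η : ℝ, 0 < α ∧ α < 1 ∧ 0 < η ∧ η < 1 ∧
      2 * η < 1 ∧ 40 * α < 2 * η ∧ 0 < 40 * α ∧
      ∀ (S U Sstar : Set E3) (v : E3 → E3) (δ₀ : E3 → ℝ),
        IsAdmissibleSurface S U Sstar v δ₀ →
        ∀ x₀ ∈ Sstar, ∃ d : ℝ, 0 < d ∧ d ∈ Ioc (δ₀ x₀) (diam S) ∧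
          (∃ T : Tetrahedron, T 0 = x₀ ∧ T 1 ∈ S ∧ T 2 ∈ S ∧ T 3 ∈ S ∧
            IsVoluminous η d T ∧
            ∀ T' : Tetrahedron, tetraDist T' T ≤ α * d →
              IsVoluminous (η / 2) (3 / 2 * d) T') ∧
          ∀ r : ℝ, r ∈ Ioc 0 d →
            (∃ (H : AffineSubspace ℝ E3) (_ : Nonempty H),
              Module.finrank ℝ H.direction = 2 ∧ x₀ ∈ H ∧
              (H : Set E3) ∩ closedBall x₀ (r / √2) ⊆
                (fun y => (EuclideanGeometry.orthogonalProjection H y : E3)) ''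
                  (S ∩ closedBall x₀ r)) ∧
            ENNReal.ofReal (π / 2 * r ^ 2) ≤ μHE[2] (S ∩ closedBall x₀ r) := by
  refine ⟨1 / 10000, 1 / 100, by norm_num, by norm_num, by norm_num, by norm_num, by norm_num,
    by norm_num, by norm_num, fun S U Sstar v δ₀ h x hx => ?_⟩
  obtain ⟨d, hδd, hdS, hsep, T, hT0, hT1, hT2, hT3, hT, hball⟩ := h.exists_stopping hx
  have hd : 0 < d := (h.radius_pos x hx).trans hδd
  refine ⟨d, hd, ⟨hδd, hdS⟩, ⟨T, hT0, hT1, hT2, hT3, ?_, fun T' hT' =>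
    hT.isVoluminous_of_tetraDist_le hd hball hT'⟩, fun r hr => ?_⟩
  · refine hT.isVoluminous (by positivity) (fun i => (hball i).trans (by linarith)) (by linarith) ?_
    rw [le_div_iff₀ (by positivity)]
    linarith
  · obtain ⟨w, hw⟩ := hsep r hr
    rw [h.eq_frontier]
    exact hw.projection hr.1
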